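/- Let $A\in\mathbb R^{n\times n}$, $B\in\mathbb R^{n\times m}$, $F\in\mathbb R_+^{n\times l}$, $H\in\mathbb R^{n\times c}$, $E\in\mathbb R_+^{m\times n}$ with no zero row, $G\in\mathbb R_+^{c\times n}$, $s\in\mathbb R^n$, $r\in\mathbb R^m$, $\gamma\in\mathbb R_+^l$, $\delta\in\mathbb R^c$. Inequalities and absolute values of vectors and matrices are entrywise. Consider the minimax problem $$\inf_\mu\ \sup_{w,v}\ \int_0^\infty\big[s^\top x+r^\top u-\gamma^\top w-\delta^\top v\big]\,d\tau$$ subject to $\dot x=Ax+Bu+Fw+Hv$, $x(0)=x_0$, $u(t)=\mu(x(t))$, $|u|\le Ex$, $w\ge 0$, $|v|\le Gx$. Here $w,v$ are locally integrable, and $\mu$ ranges over all, possibly nonlinear, state feedback policies for which $|\mu(x)|\le Ex$ for all $x\ge0$ and the closed loop has a solution on $[0,\infty)$ from every $x_0\ge 0$ against every disturbance ($w\ge0$ locally integrable, $v_k=\theta_k\,(Gx)_k$ with $\theta_k$ measurable and $|\theta_k|\le1$). The supremum is over all solutions, and the integral is $\limsup_{T\to\infty}\int_0^T$ in $[-\infty,\infty]$.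 Suppose that $A-|B|E$ is Metzler (its off-diagonal entries are nonnegative), that the dynamics are positive (whenever $x\ge0$, $|u|\le Ex$, $w\ge0$, $|v|\le Gx$ and $x_i=0$, one has $(Ax+Bu+Fw+Hv)_i\ge0$; if $G=0$ or $H=0$, this follows from the Metzler condition), and that $s\ge E^\top|r|-G^\top|\delta|$. Then the following are equivalent: (i) the minimax problem has a finite value for every $x_0\in\mathbb R^n_+$; (ii) there is $p\in\mathbb R^n_+$ with $A^\top p=E^\top|r+B^\top p|-G^\top|-\delta+H^\top p|-s$ and $\gamma\ge F^\top p$. Moreover, if they hold, there is an entrywise least $p$ as in (ii); for this $p$ the value of the minimax problem is $p^\top x_0$ for every $x_0\ge0$, and every control law $u=-Kx$ with $K=DE$, $D=\operatorname{diag}(d_1,\dots,d_m)$, $d_i\in\operatorname{sign}(r_i+(B^\top p)_i)$ is optimal for every $x_0\ge0$, where $\operatorname{sign}(y)$ is $\{1\}$ for $y>0$, $\{-1\}$ for $y<0$, and $[-1,1]$ for $y=0$. -/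

import Mathlib

open MeasureTheory Filter Matrix

noncomputable section

/-- The data of the minimax linear regulator problem: `n` states, `m` controls,
`l` nonnegative disturbances `w` and `c` elementwise bounded disturbances `v`. -/
structure RegulatorData (n m l c : ℕ) where
  A : Matrix (Fin n) (Fin n) ℝ
  B : Matrix (Fin n) (Fin m) ℝ
  F : Matrix (Fin n) (Fin l) ℝ
  H : Matrix (Fin n) (Fin c) ℝ
  E : Matrix (Fin m) (Fin n) ℝ
  G : Matrix (Fin c) (Fin n) ℝ
  s : Fin n → ℝ
  r : Fin m → ℝ
  γ : Fin l → ℝ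
  δ : Fin c → ℝ

/-- A square matrix is Metzler if its off-diagonal entries are nonnegative. -/
def IsMetzler {n : ℕ} (M : Matrix (Fin n) (Fin n) ℝ) : Prop :=
  ∀ i j, i ≠ j → 0 ≤ M i j

/-- The entrywise absolute value of a matrix. -/
def entryAbs {m n : ℕ} (M : Matrix (Fin m) (Fin n) ℝ) : Matrix (Fin m) (Fin n) ℝ :=
  fun i j => |M i j|

/-- The set-valued signature of a real number. -/
def signSet (x : ℝ) : Set ℝ :=
  if 0 < x then {1} else if x < 0 then {-1} else Set.Icc (-1) 1

/-- A time signal is locally integrable on `[0, ∞)`. -/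
def LocIntegrable {k : ℕ} (f : ℝ → Fin k → ℝ) : Prop :=
  ∀ T : ℝ, 0 ≤ T → IntervalIntegrable f volume 0 T

namespace RegulatorData

variable {n m l c : ℕ} (S : RegulatorData n m l c)

/-- The velocity `A x + B u + F w + H v`. -/
def velocity (x : Fin n → ℝ) (u : Fin m → ℝ) (w : Fin l → ℝ) (v : Fin c → ℝ) : Fin n → ℝ :=
  S.A *ᵥ x + S.B *ᵥ u + S.F *ᵥ w + S.H *ᵥ v

/-- The running cost `sᵀx + rᵀu - γᵀw - δᵀv`. -/
def stageCost (x : Fin n → ℝ) (u : Fin m → ℝ) (w : Fin l → ℝ) (v : Fin c → ℝ) : ℝ :=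
  S.s ⬝ᵥ x + S.r ⬝ᵥ u - S.γ ⬝ᵥ w - S.δ ⬝ᵥ v

/-- The dynamics are positive: at every state of the nonnegative orthant and for all values of
control and disturbances that obey the constraints there, the velocity does not point out of the
orthant. -/
def PositiveDynamics : Prop :=
  ∀ (x : Fin n → ℝ) (u : Fin m → ℝ) (w : Fin l → ℝ) (v : Fin c → ℝ),
    0 ≤ x → |u| ≤ S.E *ᵥ x → 0 ≤ w → |v| ≤ S.G *ᵥ x →
      ∀ i, x i = 0 → 0 ≤ S.velocity x u w v i

/-- `(x, w, v)` is a play from `x₀` under the state feedback `u(t) = μ(x(t))`: the signals are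
locally integrable, the constraints `|u| ≤ E x`, `w ≥ 0`, `|v| ≤ G x` hold at all times `t ≥ 0`,
and the state equation with `x(0) = x₀` holds in the sense of Carathéodory (integrated form).
Only times `t ≥ 0` matter. -/
structure IsPlay (μ : (Fin n → ℝ) → Fin m → ℝ) (x₀ : Fin n → ℝ)
    (x : ℝ → Fin n → ℝ) (w : ℝ → Fin l → ℝ) (v : ℝ → Fin c → ℝ) : Prop where
  continuousOn_state : ContinuousOn x (Set.Ici 0)
  control_integrable : LocIntegrable (fun t => μ (x t))
  w_integrable : LocIntegrable w
  v_integrable : LocIntegrable v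
  control_le : ∀ t, 0 ≤ t → |μ (x t)| ≤ S.E *ᵥ x t
  w_nonneg : ∀ t, 0 ≤ t → 0 ≤ w t
  v_le : ∀ t, 0 ≤ t → |v t| ≤ S.G *ᵥ x t
  state_eq : ∀ t, 0 ≤ t → x t = x₀ + ∫ τ in (0 : ℝ)..t, S.velocity (x τ) (μ (x τ)) (w τ) (v τ)

/-- A (possibly nonlinear, possibly discontinuous) state feedback policy `μ` is admissible if it
obeys `|μ(x)| ≤ E x` on the nonnegative orthant and the closed loop has a solution on `[0, ∞)` from
every initial state `x₀ ≥ 0` against every disturbance: every locally integrable `w ≥ 0` and every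
bounded disturbance. The signals `v` with `|v| ≤ G x` are written as `v_k(t) = θ_k(t) (G x(t))_k`
with a measurable `|θ| ≤ 1`, since their bound depends on the state. -/
structure IsAdmissible (μ : (Fin n → ℝ) → Fin m → ℝ) : Prop where
  constraint : ∀ x, 0 ≤ x → |μ x| ≤ S.E *ᵥ x
  exists_play : ∀ x₀ : Fin n → ℝ, 0 ≤ x₀ →
    ∀ w : ℝ → Fin l → ℝ, LocIntegrable w → (∀ t, 0 ≤ t → 0 ≤ w t) →
    ∀ θ : ℝ → Fin c → ℝ, Measurable θ → (∀ t k, |θ t k| ≤ 1) →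
      ∃ x : ℝ → Fin n → ℝ, S.IsPlay μ x₀ x w (fun t => θ t * (S.G *ᵥ x t))

/-- The infinite-horizon cost of a play, as an extended real number. It is the limit of the
finite-horizon costs as the horizon tends to infinity when that limit exists in `[-∞, ∞]`, and
their upper limit otherwise. -/
def cost (μ : (Fin n → ℝ) → Fin m → ℝ)
    (x : ℝ → Fin n → ℝ) (w : ℝ → Fin l → ℝ) (v : ℝ → Fin c → ℝ) : EReal :=
  limsup (fun T : ℝ =>
    ((∫ τ in (0 : ℝ)..T, S.stageCost (x τ) (μ (x τ)) (w τ) (v τ) : ℝ) : EReal)) atTop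

/-- The worst-case cost of the policy `μ` from `x₀`: the supremum over all plays. -/
def worstCost (μ : (Fin n → ℝ) → Fin m → ℝ) (x₀ : Fin n → ℝ) : EReal :=
  ⨆ (x : ℝ → Fin n → ℝ) (w : ℝ → Fin l → ℝ) (v : ℝ → Fin c → ℝ) (_ : S.IsPlay μ x₀ x w v),
    S.cost μ x w v

/-- The value of the minimax problem: infimum over admissible policies of the worst-case cost. -/
def value (x₀ : Fin n → ℝ) : EReal :=
  ⨅ (μ : (Fin n → ℝ) → Fin m → ℝ) (_ : S.IsAdmissible μ), S.worstCost μ x₀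

/-- The minimax problem has a finite value for every initial state in the nonnegative orthant. -/
def HasFiniteValue : Prop :=
  ∀ x₀ : Fin n → ℝ, 0 ≤ x₀ → S.value x₀ ≠ ⊤ ∧ S.value x₀ ≠ ⊥

/-- An admissible policy is optimal if its worst-case cost is the value, from every `x₀ ≥ 0`. -/
def IsOptimal (μ : (Fin n → ℝ) → Fin m → ℝ) : Prop :=
  S.IsAdmissible μ ∧ ∀ x₀ : Fin n → ℝ, 0 ≤ x₀ → S.worstCost μ x₀ = S.value x₀

/-- The vectors `p ≥ 0` with `Aᵀp = Eᵀ|r + Bᵀp| - Gᵀ|-δ + Hᵀp| - s` and `γ ≥ Fᵀp`. -/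
def bellmanSet : Set (Fin n → ℝ) :=
  {p | 0 ≤ p ∧
    S.Aᵀ *ᵥ p = S.Eᵀ *ᵥ |S.r + S.Bᵀ *ᵥ p| - S.Gᵀ *ᵥ |(-S.δ) + S.Hᵀ *ᵥ p| - S.s ∧
    S.Fᵀ *ᵥ p ≤ S.γ}

/-- The matrices whose `i`-th row belongs to `sign(r_i + pᵀB_i) E_i`. -/
def gainSet (p : Fin n → ℝ) : Set (Matrix (Fin m) (Fin n) ℝ) :=
  {K | ∃ d : Fin m → ℝ, (∀ i, d i ∈ signSet (S.r i + (S.Bᵀ *ᵥ p) i)) ∧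
    K = Matrix.diagonal d * S.E}

end RegulatorData

end

theorem intervalIntegrable_clm_apply {V : Type*} [NormedAddCommGroup V] [NormedSpace ℝ V]
    {N : ℝ → V →L[ℝ] V} {L : ℝ} (hL : ∀ t, ‖N t‖ ≤ L)
    (hmeas : ∀ y : ℝ → V, Continuous y → AEStronglyMeasurable (fun t => N t (y t)) volume)
    {y : ℝ → V} (hy : Continuous y) (a b : ℝ) :
    IntervalIntegrable (fun t => N t (y t)) volume a b := by
  refine IntervalIntegrable.mono_fun' (g := fun t => L * ‖y t‖)
    ((continuous_const.mul hy.norm).intervalIntegrable a b) (hmeas y hy).restrict ?_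
  exact Eventually.of_forall fun t => (N t).le_of_opNorm_le (hL t) (y t)

/-- Linear Volterra equations with bounded measurable coefficients have global solutions. -/
theorem exists_solution_linear_volterra {V : Type*} [NormedAddCommGroup V] [NormedSpace ℝ V]
    [CompleteSpace V] (N : ℝ → V →L[ℝ] V) {L : ℝ} (hL : ∀ t, ‖N t‖ ≤ L)
    (hmeas : ∀ y : ℝ → V, Continuous y → AEStronglyMeasurable (fun t => N t (y t)) volume)
    (φ : ℝ → V) (hφ : Continuous φ) :
    ∃ x : ℝ → V, ContinuousOn x (Set.Ici 0) ∧
      ∀ t, 0 ≤ t → x t = φ t + ∫ τ in (0 : ℝ)..t, N τ (x τ) := by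
  have hL0 : 0 ≤ L := (norm_nonneg _).trans (hL 0)
  let y : ℕ → ℝ → V := fun k => Nat.rec φ (fun _ z t => ∫ τ in (0 : ℝ)..t, N τ (z τ)) k
  have y_succ : ∀ k t, y (k + 1) t = ∫ τ in (0 : ℝ)..t, N τ (y k τ) := fun k t => rfl
  have y_cont : ∀ k, Continuous (y k) := by
    intro k
    induction k with
    | zero => exact hφ
    | succ k ih =>
      exact intervalIntegral.continuous_primitive
        (fun a b => intervalIntegrable_clm_apply hL hmeas ih a b) 0
  have y_bound : ∀ T : ℝ, ∃ C, 0 ≤ C ∧ ∀ k, ∀ t ∈ Set.Icc 0 T,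
      ‖y k t‖ ≤ C * ((L * t) ^ k / k.factorial) := by
    intro T
    obtain ⟨C, hC⟩ := isCompact_Icc.exists_bound_of_continuousOn (s := Set.Icc 0 T)
      hφ.continuousOn
    refine ⟨max C 0, le_max_right _ _, fun k => ?_⟩
    induction k with
    | zero => intro t ht; simpa using Or.inl (show ‖y 0 t‖ ≤ C from hC t ht)
    | succ k ih =>
      intro t ht
      rw [y_succ]
      have h1 : ‖∫ τ in (0 : ℝ)..t, N τ (y k τ)‖ ≤
          ∫ τ in (0 : ℝ)..t, (max C 0 * L ^ (k + 1) / k.factorial) * τ ^ k := by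
        refine intervalIntegral.norm_integral_le_of_norm_le ht.1 ?_
          ((continuous_const.mul (continuous_pow k)).intervalIntegrable _ _)
        refine Eventually.of_forall fun τ hτ => ?_
        have h2 := ih τ ⟨hτ.1.le, hτ.2.trans ht.2⟩
        calc ‖N τ (y k τ)‖ ≤ L * ‖y k τ‖ := (N τ).le_of_opNorm_le (hL τ) _
          _ ≤ L * (max C 0 * ((L * τ) ^ k / k.factorial)) := by gcongr
          _ = _ := by rw [mul_pow]; ring
      refine h1.trans (le_of_eq ?_)
      rw [intervalIntegral.integral_const_mul, integral_pow, Nat.factorial_succ]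
      push_cast
      have : (k.factorial : ℝ) ≠ 0 := by positivity
      have : (k : ℝ) + 1 ≠ 0 := by positivity
      field_simp
      ring
  have y_unif : ∀ T : ℝ, ∃ u : ℕ → ℝ, Summable u ∧ ∀ k, ∀ t ∈ Set.Icc 0 T, ‖y k t‖ ≤ u k := by
    intro T
    obtain ⟨C, hC0, hC⟩ := y_bound T
    refine ⟨fun k => C * ((L * T) ^ k / k.factorial),
      (Real.summable_pow_div_factorial _).mul_left C, fun k t ht => (hC k t ht).trans ?_⟩
    have h0 : 0 ≤ L * t := mul_nonneg hL0 ht.1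
    have h1 : L * t ≤ L * T := mul_le_mul_of_nonneg_left ht.2 hL0
    change C * _ ≤ C * _
    gcongr
  refine ⟨fun t => ∑' k, y k t, ?_, ?_⟩
  · intro t ht
    obtain ⟨u, hu, hy⟩ := y_unif (t + 1)
    have hc : ContinuousOn (fun t => ∑' k, y k t) (Set.Icc 0 (t + 1)) :=
      continuousOn_tsum (fun k => (y_cont k).continuousOn) hu hy
    refine (hc t ⟨ht, by linarith⟩).mono_of_mem_nhdsWithin ?_
    exact mem_nhdsWithin.2 ⟨Set.Iio (t + 1), isOpen_Iio, by simp, fun z hz => ⟨hz.2, hz.1.le⟩⟩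
  · intro t ht
    obtain ⟨u, hu, hy⟩ := y_unif t
    have hsum : ∀ τ ∈ Set.Icc 0 t, Summable fun k => y k τ := fun τ hτ =>
      Summable.of_norm_bounded hu fun k => hy k τ hτ
    have key : HasSum (fun k => ∫ τ in (0 : ℝ)..t, N τ (y k τ))
        (∫ τ in (0 : ℝ)..t, N τ (∑' k, y k τ)) := by
      refine intervalIntegral.hasSum_integral_of_dominated_convergence (fun k _ => L * u k)
        (fun k => (hmeas _ (y_cont k)).restrict) ?_ ?_ (by simp) ?_
      · refine fun k => Eventually.of_forall fun τ hτ => ?_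
        rw [Set.uIoc_of_le ht] at hτ
        exact ((N τ).le_of_opNorm_le (hL τ) _).trans
          (mul_le_mul_of_nonneg_left (hy k τ ⟨hτ.1.le, hτ.2⟩) hL0)
      · exact Eventually.of_forall fun τ hτ => hu.mul_left L
      · refine Eventually.of_forall fun τ hτ => ?_
        rw [Set.uIoc_of_le ht] at hτ
        exact (hsum τ ⟨hτ.1.le, hτ.2⟩).hasSum.mapL (N τ)
    change ∑' k, y k t = φ t + ∫ τ in (0 : ℝ)..t, N τ (∑' k, y k τ)
    rw [(hsum t ⟨ht, le_rfl⟩).tsum_eq_zero_add, ← key.tsum_eq]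
    rfl

/-- A continuous nonnegative function dominated by a multiple of its own primitive vanishes. -/
theorem eq_zero_of_le_mul_integral {g : ℝ → ℝ} (hg : ContinuousOn g (Set.Ici 0))
    (h0 : ∀ t, 0 ≤ t → 0 ≤ g t) {C : ℝ}
    (hC : ∀ t, 0 ≤ t → g t ≤ C * ∫ τ in (0 : ℝ)..t, g τ) (t : ℝ) (ht : 0 ≤ t) : g t = 0 := by
  let f : ℝ → ℝ := fun t => g (max t 0)
  have hf : Continuous f :=
    hg.comp_continuous (continuous_id.max continuous_const) fun t =>
      Set.mem_Ici.2 (le_max_right _ _)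
  have hfg : ∀ t, 0 ≤ t → f t = g t := fun t ht => by simp [f, max_eq_left ht]
  have hint : ∀ t, 0 ≤ t → ∫ τ in (0 : ℝ)..t, g τ = ∫ τ in (0 : ℝ)..t, f τ := fun t ht => by
    refine intervalIntegral.integral_congr fun τ hτ => ?_
    rw [Set.uIcc_of_le ht] at hτ
    exact (hfg τ hτ.1).symm
  have hnn : ∀ t, 0 ≤ t → 0 ≤ ∫ τ in (0 : ℝ)..t, f τ := fun t ht =>
    intervalIntegral.integral_nonneg ht fun τ hτ => by rw [hfg τ hτ.1]; exact h0 τ hτ.1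
  have hderiv : ∀ s, HasDerivAt (fun s => ∫ τ in (0 : ℝ)..s, f τ) (f s) s := fun s =>
    (hf.integral_hasStrictDerivAt 0 s).hasDerivAt
  have hG := norm_le_gronwallBound_of_norm_deriv_right_le
    (f := fun s => ∫ τ in (0 : ℝ)..s, f τ) (f' := f) (δ := 0) (K := C) (ε := 0) (a := 0) (b := t)
    (fun s _ => (hderiv s).continuousAt.continuousWithinAt)
    (fun s _ => (hderiv s).hasDerivWithinAt) (by simp)
    (fun s hs => by
      rw [Real.norm_of_nonneg (hnn s hs.1),
        Real.norm_of_nonneg (by rw [hfg s hs.1]; exact h0 s hs.1),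
        hfg s hs.1, ← hint s hs.1, add_zero]
      exact hC s hs.1) t ⟨ht, le_rfl⟩
  rw [gronwallBound_ε0, zero_mul, norm_le_zero_iff] at hG
  refine le_antisymm ((hC t ht).trans ?_) (h0 t ht)
  rw [hint t ht, hG, mul_zero]

namespace LocIntegrable

variable {k : ℕ} {f g : ℝ → Fin k → ℝ}

theorem intervalIntegrable (hf : LocIntegrable f) {a b : ℝ} (ha : 0 ≤ a) (hb : 0 ≤ b) :
    IntervalIntegrable f volume a b :=
  (hf a ha).symm.trans (hf b hb)

theorem apply (hf : LocIntegrable f) (i : Fin k) {a b : ℝ} (ha : 0 ≤ a) (hb : 0 ≤ b) :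
    IntervalIntegrable (fun t => f t i) volume a b :=
  ⟨(hf.intervalIntegrable ha hb).1.eval i, (hf.intervalIntegrable ha hb).2.eval i⟩

theorem of_apply (hf : ∀ i, ∀ T : ℝ, 0 ≤ T → IntervalIntegrable (fun t => f t i) volume 0 T) :
    LocIntegrable f := fun T hT =>
  ⟨Integrable.of_eval fun i => (hf i T hT).1, Integrable.of_eval fun i => (hf i T hT).2⟩

theorem of_continuousOn (hf : ContinuousOn f (Set.Ici 0)) : LocIntegrable f := fun T hT => by
  refine ContinuousOn.intervalIntegrable (hf.mono ?_)
  rw [Set.uIcc_of_le hT]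
  exact Set.Icc_subset_Ici_self

theorem add (hf : LocIntegrable f) (hg : LocIntegrable g) : LocIntegrable (fun t => f t + g t) :=
  fun T hT => (hf T hT).add (hg T hT)

theorem mulVec {j : ℕ} (hf : LocIntegrable f) (M : Matrix (Fin j) (Fin k) ℝ) :
    LocIntegrable (fun t => M *ᵥ f t) := fun T hT =>
  ⟨(M.mulVecLin.toContinuousLinearMap).integrable_comp (hf T hT).1,
    (M.mulVecLin.toContinuousLinearMap).integrable_comp (hf T hT).2⟩

theorem dotProduct (hf : LocIntegrable f) (q : Fin k → ℝ) {a b : ℝ} (ha : 0 ≤ a) (hb : 0 ≤ b) :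
    IntervalIntegrable (fun t => q ⬝ᵥ f t) volume a b := by
  have := IntervalIntegrable.sum (μ := volume) (a := a) (b := b) Finset.univ
    (f := fun i t => q i * f t i) fun i _ => (hf.apply i ha hb).const_mul (q i)
  refine this.congr fun t _ => ?_
  simp [_root_.dotProduct]

theorem integral_apply (hf : LocIntegrable f) (i : Fin k) {a b : ℝ} (ha : 0 ≤ a) (hb : 0 ≤ b) :
    (∫ t in a..b, f t) i = ∫ t in a..b, f t i :=
  ((ContinuousLinearMap.proj (R := ℝ) (φ := fun _ : Fin k => ℝ) i).intervalIntegral_comp_comm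
    (hf.intervalIntegrable ha hb)).symm

theorem integral_dotProduct (hf : LocIntegrable f) (q : Fin k → ℝ) {a b : ℝ} (ha : 0 ≤ a)
    (hb : 0 ≤ b) : ∫ t in a..b, q ⬝ᵥ f t = q ⬝ᵥ ∫ t in a..b, f t := by
  simp only [_root_.dotProduct]
  rw [intervalIntegral.integral_finsetSum fun i _ => (hf.apply i ha hb).const_mul (q i)]
  simp [hf.integral_apply _ ha hb]

theorem continuousOn_primitive (hf : LocIntegrable f) :
    ContinuousOn (fun t => ∫ τ in (0 : ℝ)..t, f τ) (Set.Ici 0) := by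
  intro t ht
  have ht1 : (0 : ℝ) ≤ t + 1 := add_nonneg ht zero_le_one
  have hc := intervalIntegral.continuousOn_primitive_interval' (hf (t + 1) ht1)
    Set.left_mem_uIcc
  rw [Set.uIcc_of_le ht1] at hc
  refine (hc t ⟨ht, by linarith⟩).mono_of_mem_nhdsWithin ?_
  exact mem_nhdsWithin.2 ⟨Set.Iio (t + 1), isOpen_Iio, by simp, fun z hz => ⟨hz.2, hz.1.le⟩⟩

end LocIntegrable

/-- Forward invariance of the nonnegative orthant for Carathéodory solutions whose velocity is
bounded below, in each nonpositive coordinate, by the total negative part of the state. -/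
theorem nonneg_of_velocity_ge {k : ℕ} {x g : ℝ → Fin k → ℝ} {x₀ : Fin k → ℝ} (hx₀ : 0 ≤ x₀)
    (hx : ContinuousOn x (Set.Ici 0)) (hg : LocIntegrable g)
    (heq : ∀ t, 0 ≤ t → x t = x₀ + ∫ τ in (0 : ℝ)..t, g τ) {C : ℝ} (hC : 0 ≤ C)
    (hlow : ∀ t, 0 ≤ t → ∀ i, x t i ≤ 0 → -(C * ∑ j, max (-x t j) 0) ≤ g t i)
    (t : ℝ) (ht : 0 ≤ t) : 0 ≤ x t := by
  set N : ℝ → ℝ := fun t => ∑ j, max (-x t j) 0 with hN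
  have hxi : ∀ i, ContinuousOn (fun t => x t i) (Set.Ici 0) := fun i =>
    (continuous_apply i).comp_continuousOn hx
  have hNc : ContinuousOn N (Set.Ici 0) :=
    continuousOn_finsetSum _ fun j _ => ContinuousOn.sup (hxi j).neg continuousOn_const
  have hN0 : ∀ t, 0 ≤ N t := fun t => Finset.sum_nonneg fun j _ => le_max_right _ _
  have hNint : ∀ a b : ℝ, 0 ≤ a → 0 ≤ b → IntervalIntegrable N volume a b := fun a b ha hb =>
    ContinuousOn.intervalIntegrable (hNc.mono fun z hz => (le_min ha hb).trans hz.1)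
  have hcoord : ∀ t, 0 ≤ t → ∀ i, max (-x t i) 0 ≤ C * ∫ τ in (0 : ℝ)..t, N τ := by
    intro t ht i
    have hpos : 0 ≤ C * ∫ τ in (0 : ℝ)..t, N τ :=
      mul_nonneg hC (intervalIntegral.integral_nonneg ht fun τ _ => hN0 τ)
    refine max_le ?_ hpos
    by_cases hneg : 0 ≤ x t i
    · linarith
    push Not at hneg
    have hcpt : IsCompact (Set.Icc 0 t ∩ (fun s => x s i) ⁻¹' Set.Ici 0) :=
      isCompact_Icc.of_isClosed_subset
        (((hxi i).mono Set.Icc_subset_Ici_self).preimage_isClosed_of_isClosed isClosed_Icc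
          isClosed_Ici) Set.inter_subset_left
    have hx0 : x 0 = x₀ := by simpa using heq 0 le_rfl
    obtain ⟨σ, ⟨⟨hσ0, hσt⟩, hσ⟩, hmax⟩ := hcpt.exists_isGreatest
      ⟨0, ⟨le_rfl, ht⟩, by simpa [hx0] using hx₀ i⟩
    have hval : ∀ s, 0 ≤ s → x s i = x₀ i + ∫ τ in (0 : ℝ)..s, g τ i := fun s hs => by
      rw [heq s hs, Pi.add_apply, hg.integral_apply i le_rfl hs]
    have hsplit : x t i = x σ i + ∫ τ in σ..t, g τ i := by
      rw [hval t ht, hval σ hσ0, add_assoc, intervalIntegral.integral_add_adjacent_intervals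
        (hg.apply i le_rfl hσ0) (hg.apply i hσ0 ht)]
    have hle : ∫ τ in σ..t, -(C * N τ) ≤ ∫ τ in σ..t, g τ i := by
      refine intervalIntegral.integral_mono_on_of_le_Ioo hσt ((hNint σ t hσ0 ht).const_mul C).neg
        (hg.apply i hσ0 ht) fun τ hτ => hlow τ (hσ0.trans hτ.1.le) i ?_
      by_contra hcon
      push Not at hcon
      exact absurd (hmax ⟨⟨hσ0.trans hτ.1.le, hτ.2.le⟩, hcon.le⟩) (not_le.2 hτ.1)
    have hsub : ∫ τ in σ..t, N τ ≤ ∫ τ in (0 : ℝ)..t, N τ := by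
      rw [← intervalIntegral.integral_add_adjacent_intervals (hNint 0 σ le_rfl hσ0)
        (hNint σ t hσ0 ht)]
      have := intervalIntegral.integral_nonneg (μ := volume) hσ0 fun τ _ => hN0 τ
      linarith
    rw [intervalIntegral.integral_neg, intervalIntegral.integral_const_mul] at hle
    have := mul_le_mul_of_nonneg_left hsub hC
    have hσ' : 0 ≤ x σ i := hσ
    linarith
  have hzero := eq_zero_of_le_mul_integral hNc (fun t _ => hN0 t) (C := k * C) (fun t ht => by
    calc N t ≤ ∑ _j : Fin k, C * ∫ τ in (0 : ℝ)..t, N τ :=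
          Finset.sum_le_sum fun j _ => hcoord t ht j
      _ = _ := by simp [mul_assoc]) t ht
  intro i
  have hi := (Finset.sum_eq_zero_iff_of_nonneg fun j _ => le_max_right _ _).1 hzero i
    (Finset.mem_univ i)
  have : -x t i ≤ 0 := (le_max_left _ _).trans hi.le
  simpa using this

theorem abs_eq_sign_mul (y : ℝ) : (if 0 ≤ y then 1 else -1) * y = |y| := by
  split_ifs with h
  · rw [one_mul, abs_of_nonneg h]
  · rw [abs_of_neg (not_le.1 h), neg_one_mul]

theorem mul_eq_abs_of_mem_signSet {d y : ℝ} (h : d ∈ signSet y) : d * y = |y| := by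
  unfold signSet at h
  split_ifs at h with h1 h2
  · rw [Set.mem_singleton_iff.1 h, one_mul, abs_of_pos h1]
  · rw [Set.mem_singleton_iff.1 h, neg_one_mul, abs_of_neg h2]
  · rw [le_antisymm (not_lt.1 h1) (not_lt.1 h2), mul_zero, abs_zero]

theorem abs_le_one_of_mem_signSet {d y : ℝ} (h : d ∈ signSet y) : |d| ≤ 1 := by
  unfold signSet at h
  split_ifs at h
  · simp [Set.mem_singleton_iff.1 h]
  · simp [Set.mem_singleton_iff.1 h]
  · exact abs_le.2 h

theorem mulVec_nonneg_of_nonneg {a b : ℕ} {M : Matrix (Fin a) (Fin b) ℝ} (hM : ∀ i j, 0 ≤ M i j)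
    {x : Fin b → ℝ} (hx : 0 ≤ x) : 0 ≤ M *ᵥ x := fun i => by
  rw [Pi.zero_apply, mulVec, dotProduct]
  exact Finset.sum_nonneg fun j _ => mul_nonneg (hM i j) (hx j)

theorem abs_mulVec_le {a b : ℕ} (M : Matrix (Fin a) (Fin b) ℝ) {x y : Fin b → ℝ}
    (h : |x| ≤ y) (i : Fin a) : |(M *ᵥ x) i| ≤ (entryAbs M *ᵥ y) i := by
  simp only [mulVec, dotProduct]
  refine (Finset.abs_sum_le_sum_abs _ _).trans (Finset.sum_le_sum fun j _ => ?_)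
  rw [abs_mul]
  exact mul_le_mul_of_nonneg_left (h j) (abs_nonneg _)

theorem transpose_mulVec_dotProduct {a b : ℕ} (M : Matrix (Fin a) (Fin b) ℝ) (y : Fin a → ℝ)
    (x : Fin b → ℝ) : (Mᵀ *ᵥ y) ⬝ᵥ x = y ⬝ᵥ (M *ᵥ x) := by
  rw [mulVec_transpose, dotProduct_mulVec]

/-- The negative part of the state controls from below what a Metzler matrix does to a
nonpositive coordinate. -/
theorem IsMetzler.mulVec_ge {k : ℕ} {M : Matrix (Fin k) (Fin k) ℝ} (hM : IsMetzler M) {C : ℝ}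
    (hC : ∀ i j, M i j ≤ C) (x : Fin k → ℝ) (i : Fin k) (hi : x i ≤ 0) :
    -(C * ∑ j, max (-x j) 0) ≤ (M *ᵥ x) i := by
  rw [Finset.mul_sum, ← Finset.sum_neg_distrib]
  refine Finset.sum_le_sum fun j _ => ?_
  by_cases hij : i = j
  · subst hij
    rw [max_eq_left (by linarith)]
    nlinarith [hC i i]
  · have h0 := hM i j hij
    have h1 := hC i j
    rcases le_total 0 (x j) with hx | hx
    · rw [max_eq_right (by linarith), mul_zero, neg_zero]
      positivity
    · rw [max_eq_left (by linarith)]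
      nlinarith

namespace RegulatorData

variable {n m l c : ℕ} (S : RegulatorData n m l c)

/-- The matrix `A - |B|E - |H|G` of the slowest admissible dynamics. -/
def slowMatrix : Matrix (Fin n) (Fin n) ℝ :=
  S.A - entryAbs S.B * S.E - entryAbs S.H * S.G

/-- The residual `s + Aᵀp - Eᵀ|r + Bᵀp| + Gᵀ|-δ + Hᵀp|` of the Bellman equation. -/
def bellmanResidual (p : Fin n → ℝ) : Fin n → ℝ :=
  S.s + S.Aᵀ *ᵥ p - S.Eᵀ *ᵥ |S.r + S.Bᵀ *ᵥ p| + S.Gᵀ *ᵥ |(-S.δ) + S.Hᵀ *ᵥ p|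

/-- The disturbance gains maximizing the running cost against the co-state `q`. -/
noncomputable def worstGain (q : Fin n → ℝ) : Fin c → ℝ :=
  fun k => if 0 ≤ ((-S.δ) + S.Hᵀ *ᵥ q) k then 1 else -1

variable {S}

theorem mem_bellmanSet_iff {p : Fin n → ℝ} :
    p ∈ S.bellmanSet ↔ 0 ≤ p ∧ S.bellmanResidual p = 0 ∧ S.Fᵀ *ᵥ p ≤ S.γ := by
  have : S.Aᵀ *ᵥ p = S.Eᵀ *ᵥ |S.r + S.Bᵀ *ᵥ p| - S.Gᵀ *ᵥ |(-S.δ) + S.Hᵀ *ᵥ p| - S.s ↔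
      S.bellmanResidual p = 0 := by
    unfold bellmanResidual
    constructor
    · intro h
      rw [h]
      abel
    · intro h
      rw [← sub_eq_zero, ← h]
      abel
  simp only [bellmanSet, Set.mem_ofPred_eq, this]

theorem bellmanResidual_zero_nonneg (hs : S.Eᵀ *ᵥ |S.r| - S.Gᵀ *ᵥ |S.δ| ≤ S.s) :
    0 ≤ S.bellmanResidual 0 := by
  intro i
  have := hs i
  simp only [bellmanResidual, mulVec_zero, add_zero, abs_neg, Pi.add_apply, Pi.sub_apply,
    Pi.zero_apply] at this ⊢
  linarith

theorem continuous_bellmanResidual : Continuous S.bellmanResidual := by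
  have habs : ∀ k : ℕ, Continuous fun y : Fin k → ℝ => |y| := fun k =>
    continuous_pi fun i => (continuous_apply i).abs
  have hmul : ∀ {a b : ℕ} (M : Matrix (Fin a) (Fin b) ℝ), Continuous fun y => M *ᵥ y := fun M =>
    continuous_const.matrix_mulVec continuous_id
  unfold bellmanResidual
  exact ((continuous_const.add (hmul _)).sub
    ((hmul _).comp ((habs _).comp (continuous_const.add (hmul _))))).add
    ((hmul _).comp ((habs _).comp (continuous_const.add (hmul _))))

theorem isMetzler_slowMatrix (hE : ∀ i j, 0 ≤ S.E i j) (hG : ∀ i j, 0 ≤ S.G i j)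
    (hpos : S.PositiveDynamics) : IsMetzler S.slowMatrix := by
  intro i j hij
  have habs : ∀ y : ℝ, |(if 0 ≤ y then (1 : ℝ) else -1)| = 1 := fun y => by split_ifs <;> simp
  have h := hpos (Pi.single j 1) (fun k => -((if 0 ≤ S.B i k then 1 else -1) * S.E k j)) 0
    (fun k => -((if 0 ≤ S.H i k then 1 else -1) * S.G k j))
    (Pi.single_nonneg.2 zero_le_one)
    (fun k => by
      rw [Pi.abs_apply, abs_neg, abs_mul, habs, one_mul, abs_of_nonneg (hE k j),
        mulVec_single_one, col_apply]) le_rfl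
    (fun k => by
      rw [Pi.abs_apply, abs_neg, abs_mul, habs, one_mul, abs_of_nonneg (hG k j),
        mulVec_single_one, col_apply]) i (by simp [hij])
  have h1 : ∀ y z : ℝ, y * -((if 0 ≤ y then 1 else -1) * z) = -(|y| * z) := fun y z => by
    rw [← abs_eq_sign_mul y]; ring
  simp only [velocity, mulVec_single_one, mulVec_zero, add_zero, Pi.add_apply, col_apply] at h
  simp only [mulVec, dotProduct, h1, Finset.sum_neg_distrib] at h
  simp only [slowMatrix, Matrix.sub_apply, Matrix.mul_apply, entryAbs]
  linarith

theorem slowMatrix_mulVec_le_velocity (hF : ∀ i j, 0 ≤ S.F i j) {x : Fin n → ℝ} {u : Fin m → ℝ}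
    {w : Fin l → ℝ} {v : Fin c → ℝ} (hu : |u| ≤ S.E *ᵥ x) (hw : 0 ≤ w) (hv : |v| ≤ S.G *ᵥ x) :
    S.slowMatrix *ᵥ x ≤ S.velocity x u w v := by
  intro i
  have h1 := (abs_le.1 (abs_mulVec_le S.B hu i)).1
  have h2 := (abs_le.1 (abs_mulVec_le S.H hv i)).1
  have h3 := mulVec_nonneg_of_nonneg hF hw i
  simp only [slowMatrix, velocity, sub_mulVec, ← mulVec_mulVec, Pi.sub_apply, Pi.add_apply,
    Pi.zero_apply] at *
  linarith

/-- The Bellman residual is quasimonotone. -/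
theorem slowMatrix_mulVec_le_bellmanResidual_sub (hE : ∀ i j, 0 ≤ S.E i j)
    (hG : ∀ i j, 0 ≤ S.G i j) {p q : Fin n → ℝ} (hpq : p ≤ q) :
    S.slowMatrixᵀ *ᵥ (q - p) ≤ S.bellmanResidual q - S.bellmanResidual p := by
  have key : ∀ {k : ℕ} (y : Fin k → ℝ) (M : Matrix (Fin n) (Fin k) ℝ)
      (N : Matrix (Fin k) (Fin n) ℝ),
      (∀ i j, 0 ≤ N i j) → ∀ i, |(Nᵀ *ᵥ |y + Mᵀ *ᵥ q|) i - (Nᵀ *ᵥ |y + Mᵀ *ᵥ p|) i| ≤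
        ((entryAbs M * N)ᵀ *ᵥ (q - p)) i := by
    intro k y M N hN i
    rw [transpose_mul, ← mulVec_mulVec, ← Pi.sub_apply, ← mulVec_sub]
    have hN' : entryAbs Nᵀ = Nᵀ := by
      ext a b
      exact abs_of_nonneg (hN b a)
    have hM' : entryAbs Mᵀ = (entryAbs M)ᵀ := rfl
    rw [← hM']
    conv_rhs => rw [← hN']
    refine abs_mulVec_le _ (fun j => ?_) i
    refine (abs_abs_sub_abs_le_abs_sub _ _).trans ?_
    have h1 : (y + Mᵀ *ᵥ q) j - (y + Mᵀ *ᵥ p) j = (Mᵀ *ᵥ (q - p)) j := by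
      simp [mulVec_sub]
    rw [h1]
    exact abs_mulVec_le _ (abs_of_nonneg (sub_nonneg.2 hpq)).le j
  intro i
  have h1 := (abs_le.1 (key S.r S.B S.E hE i)).2
  have h2 := (abs_le.1 (key (-S.δ) S.H S.G hG i)).1
  simp only [slowMatrix, bellmanResidual, transpose_sub, sub_mulVec, mulVec_sub, Pi.sub_apply,
    Pi.add_apply] at *
  linarith

theorem stageCost_add_dotProduct_velocity (q x : Fin n → ℝ) (u : Fin m → ℝ) (w : Fin l → ℝ)
    (v : Fin c → ℝ) :
    S.stageCost x u w v + q ⬝ᵥ S.velocity x u w v =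
      (S.s + S.Aᵀ *ᵥ q) ⬝ᵥ x + (S.r + S.Bᵀ *ᵥ q) ⬝ᵥ u + (S.Fᵀ *ᵥ q - S.γ) ⬝ᵥ w +
        ((-S.δ) + S.Hᵀ *ᵥ q) ⬝ᵥ v := by
  simp only [stageCost, velocity, dotProduct_add, add_dotProduct, sub_dotProduct, neg_dotProduct,
    mulVec_transpose, dotProduct_mulVec]
  ring

theorem dotProduct_worstGain_mul (q x : Fin n → ℝ) :
    ((-S.δ) + S.Hᵀ *ᵥ q) ⬝ᵥ (S.worstGain q * (S.G *ᵥ x)) =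
      (S.Gᵀ *ᵥ |(-S.δ) + S.Hᵀ *ᵥ q|) ⬝ᵥ x := by
  rw [transpose_mulVec_dotProduct]
  refine Finset.sum_congr rfl fun k _ => ?_
  rw [Pi.abs_apply, ← abs_eq_sign_mul, Pi.mul_apply, worstGain]
  ring

theorem abs_dotProduct_le_of_abs_le {k : ℕ} {y u z : Fin k → ℝ} (h : |u| ≤ z) :
    |y ⬝ᵥ u| ≤ |y| ⬝ᵥ z := by
  simp only [dotProduct]
  refine (Finset.abs_sum_le_sum_abs _ _).trans (Finset.sum_le_sum fun j _ => ?_)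
  rw [abs_mul]
  exact mul_le_mul_of_nonneg_left (h j) (abs_nonneg _)

/-- Under the disturbance gains `worstGain q`, no control can push the running cost plus the
drift of `q ⬝ᵥ x` below the Bellman residual. -/
theorem bellmanResidual_le_stageCost_add (q : Fin n → ℝ) {x : Fin n → ℝ} {u : Fin m → ℝ}
    (hu : |u| ≤ S.E *ᵥ x) (w : Fin l → ℝ) :
    S.bellmanResidual q ⬝ᵥ x + (S.Fᵀ *ᵥ q - S.γ) ⬝ᵥ w ≤
      S.stageCost x u w (S.worstGain q * (S.G *ᵥ x)) +
        q ⬝ᵥ S.velocity x u w (S.worstGain q * (S.G *ᵥ x)) := by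
  rw [stageCost_add_dotProduct_velocity, dotProduct_worstGain_mul]
  have h := (abs_le.1 (abs_dotProduct_le_of_abs_le (y := S.r + S.Bᵀ *ᵥ q) hu)).1
  rw [← transpose_mulVec_dotProduct] at h
  simp only [bellmanResidual, add_dotProduct, sub_dotProduct] at *
  linarith

/-- Under a gain in `gainSet p`, no disturbance can push the running cost plus the drift of
`p ⬝ᵥ x` above zero. -/
theorem stageCost_add_nonpos {p : Fin n → ℝ} (hp : p ∈ S.bellmanSet)
    {K : Matrix (Fin m) (Fin n) ℝ} (hK : K ∈ S.gainSet p) {x : Fin n → ℝ} {w : Fin l → ℝ}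
    {v : Fin c → ℝ} (hw : 0 ≤ w) (hv : |v| ≤ S.G *ᵥ x) :
    S.stageCost x (-(K *ᵥ x)) w v + p ⬝ᵥ S.velocity x (-(K *ᵥ x)) w v ≤ 0 := by
  obtain ⟨d, hd, rfl⟩ := hK
  obtain ⟨-, hres, hγ⟩ := mem_bellmanSet_iff.1 hp
  rw [stageCost_add_dotProduct_velocity]
  have hu : (S.r + S.Bᵀ *ᵥ p) ⬝ᵥ (-((diagonal d * S.E) *ᵥ x)) =
      -((S.Eᵀ *ᵥ |S.r + S.Bᵀ *ᵥ p|) ⬝ᵥ x) := by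
    rw [transpose_mulVec_dotProduct, dotProduct_neg, ← mulVec_mulVec]
    congr 1
    refine Finset.sum_congr rfl fun k _ => ?_
    rw [mulVec_diagonal, Pi.abs_apply, Pi.add_apply, ← mul_eq_abs_of_mem_signSet (hd k)]
    ring
  have hv' := (abs_le.1 (abs_dotProduct_le_of_abs_le (y := (-S.δ) + S.Hᵀ *ᵥ p) hv)).2
  rw [← transpose_mulVec_dotProduct] at hv'
  have hw' : (S.Fᵀ *ᵥ p - S.γ) ⬝ᵥ w ≤ 0 := by
    refine Finset.sum_nonpos fun j _ => mul_nonpos_of_nonpos_of_nonneg ?_ (hw j)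
    exact sub_nonpos.2 (hγ j)
  have hx : S.bellmanResidual p ⬝ᵥ x = 0 := by rw [hres, zero_dotProduct]
  rw [hu]
  simp only [bellmanResidual, add_dotProduct, sub_dotProduct] at *
  linarith

end RegulatorData

/-- Follow `f` up to time `T`, and `g` restarted at time `T` afterwards. -/
noncomputable def splice {α : Type*} (T : ℝ) (f g : ℝ → α) (t : ℝ) : α :=
  if t ≤ T then f t else g (t - T)

section Splice

variable {α : Type*} {T t : ℝ} {f g : ℝ → α}

theorem splice_of_le (h : t ≤ T) : splice T f g t = f t := if_pos h

theorem splice_of_lt (h : T < t) : splice T f g t = g (t - T) := if_neg (not_le.2 h)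

variable {V : Type*} [NormedAddCommGroup V] {f g : ℝ → V}

theorem integral_splice_of_le [NormedSpace ℝ V] (ht0 : 0 ≤ t) (ht : t ≤ T) :
    ∫ τ in (0 : ℝ)..t, splice T f g τ = ∫ τ in (0 : ℝ)..t, f τ := by
  refine intervalIntegral.integral_congr fun τ hτ => ?_
  rw [Set.uIcc_of_le ht0] at hτ
  exact splice_of_le (hτ.2.trans ht)

theorem intervalIntegrable_splice_left (hT : 0 ≤ T) (hf : IntervalIntegrable f volume 0 T) :
    IntervalIntegrable (splice T f g) volume 0 T := by
  refine hf.congr fun τ hτ => ?_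
  rw [Set.uIoc_of_le hT] at hτ
  exact (splice_of_le hτ.2).symm

theorem intervalIntegrable_splice_right (ht : T ≤ t)
    (hg : IntervalIntegrable g volume 0 (t - T)) :
    IntervalIntegrable (splice T f g) volume T t := by
  have h := hg.comp_sub_right T
  rw [zero_add, sub_add_cancel] at h
  refine h.congr fun τ hτ => ?_
  rw [Set.uIoc_of_le ht] at hτ
  exact (splice_of_lt hτ.1).symm

theorem integral_splice [NormedSpace ℝ V] (hT : 0 ≤ T) (ht : T ≤ t)
    (hf : IntervalIntegrable f volume 0 T)
    (hg : IntervalIntegrable g volume 0 (t - T)) :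
    ∫ τ in (0 : ℝ)..t, splice T f g τ =
      (∫ τ in (0 : ℝ)..T, f τ) + ∫ τ in (0 : ℝ)..(t - T), g τ := by
  rw [← intervalIntegral.integral_add_adjacent_intervals (intervalIntegrable_splice_left hT hf)
    (intervalIntegrable_splice_right ht hg), integral_splice_of_le hT le_rfl]
  congr 1
  have h := intervalIntegral.integral_comp_sub_right (a := T) (b := t) g T
  rw [sub_self] at h
  rw [← h]
  refine intervalIntegral.integral_congr_ae (Eventually.of_forall fun τ hτ => ?_)
  rw [Set.uIoc_of_le ht] at hτ
  exact splice_of_lt hτ.1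

theorem LocIntegrable.splice {k : ℕ} {f g : ℝ → Fin k → ℝ} (hf : LocIntegrable f)
    (hg : LocIntegrable g) (hT : 0 ≤ T) : LocIntegrable (splice T f g) := by
  intro t ht
  rcases le_total t T with h | h
  · refine (hf t ht).congr fun τ hτ => ?_
    rw [Set.uIoc_of_le ht] at hτ
    exact (splice_of_le (hτ.2.trans h)).symm
  · exact (intervalIntegrable_splice_left hT (hf T hT)).trans
      (intervalIntegrable_splice_right h (hg _ (sub_nonneg.2 h)))

theorem continuousOn_splice {k : ℕ} {f g : ℝ → Fin k → ℝ} (hf : ContinuousOn f (Set.Ici 0))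
    (hg : ContinuousOn g (Set.Ici 0)) (hfg : f T = g 0) :
    ContinuousOn (splice T f g) (Set.Ici 0) := by
  refine ContinuousOn.if (fun t ht => ?_) (hf.mono fun t ht => ht.1) ?_
  · have hfr : t ∈ frontier (Set.Iic T) := ht.2
    rw [frontier_Iic, Set.mem_singleton_iff] at hfr
    rw [hfr, sub_self, hfg]
  · refine hg.comp (continuous_id.sub continuous_const).continuousOn fun t ht => ?_
    have h : t ∈ closure (Set.Ioi T) := by
      refine closure_mono (fun s hs => ?_) ht.2
      exact not_le.1 hs
    rw [closure_Ioi] at h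
    exact sub_nonneg.2 (Set.mem_Ici.1 h)

end Splice

theorem LocIntegrable.mul_of_abs_le_one {k : ℕ} {θ f : ℝ → Fin k → ℝ} (hf : LocIntegrable f)
    (hθ : Measurable θ) (hθ1 : ∀ t i, |θ t i| ≤ 1) : LocIntegrable (fun t => θ t * f t) := by
  refine LocIntegrable.of_apply fun i T hT => ?_
  have hfi := hf.apply i le_rfl hT
  refine hfi.norm.mono_fun' (((measurable_pi_apply i).comp hθ).aestronglyMeasurable.mul
    hfi.aestronglyMeasurable_restrict_uIoc) (Eventually.of_forall fun t => ?_)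
  simp only [Pi.mul_apply, norm_mul, Real.norm_eq_abs]
  exact mul_le_of_le_one_left (abs_nonneg _) (hθ1 t i)

theorem exists_entry_bound {a b : ℕ} (M : Matrix (Fin a) (Fin b) ℝ) : ∃ C, 0 ≤ C ∧
    ∀ i j, |M i j| ≤ C :=
  ⟨∑ i, ∑ j, |M i j|, Finset.sum_nonneg fun _ _ => Finset.sum_nonneg fun _ _ => abs_nonneg _,
    fun i j => (Finset.single_le_sum (f := fun j => |M i j|) (fun _ _ => abs_nonneg _)
      (Finset.mem_univ j)).trans (Finset.single_le_sum (f := fun i => ∑ j, |M i j|)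
        (fun _ _ => Finset.sum_nonneg fun _ _ => abs_nonneg _) (Finset.mem_univ i))⟩

namespace RegulatorData

variable {n m l c : ℕ} {S : RegulatorData n m l c}

namespace IsPlay

variable {μ : (Fin n → ℝ) → Fin m → ℝ} {x₀ : Fin n → ℝ} {x : ℝ → Fin n → ℝ} {w : ℝ → Fin l → ℝ}
  {v : ℝ → Fin c → ℝ}

theorem state_integrable (h : S.IsPlay μ x₀ x w v) : LocIntegrable x :=
  LocIntegrable.of_continuousOn h.continuousOn_state

theorem velocity_integrable (h : S.IsPlay μ x₀ x w v) :
    LocIntegrable (fun τ => S.velocity (x τ) (μ (x τ)) (w τ) (v τ)) :=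
  (((h.state_integrable.mulVec S.A).add (h.control_integrable.mulVec S.B)).add
    (h.w_integrable.mulVec S.F)).add (h.v_integrable.mulVec S.H)

theorem stageCost_integrable (h : S.IsPlay μ x₀ x w v) {T : ℝ} (hT : 0 ≤ T) :
    IntervalIntegrable (fun τ => S.stageCost (x τ) (μ (x τ)) (w τ) (v τ)) volume 0 T :=
  (((h.state_integrable.dotProduct S.s le_rfl hT).add
    (h.control_integrable.dotProduct S.r le_rfl hT)).sub
    (h.w_integrable.dotProduct S.γ le_rfl hT)).sub (h.v_integrable.dotProduct S.δ le_rfl hT)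

theorem state_zero (h : S.IsPlay μ x₀ x w v) : x 0 = x₀ := by
  simpa using h.state_eq 0 le_rfl

theorem state_nonneg (hF : ∀ i j, 0 ≤ S.F i j) (hM : IsMetzler S.slowMatrix) (hx₀ : 0 ≤ x₀)
    (h : S.IsPlay μ x₀ x w v) {t : ℝ} (ht : 0 ≤ t) : 0 ≤ x t := by
  obtain ⟨C, hC0, hC⟩ := exists_entry_bound S.slowMatrix
  refine nonneg_of_velocity_ge hx₀ h.continuousOn_state h.velocity_integrable h.state_eq hC0
    (fun t ht i hi => ?_) t ht
  exact (hM.mulVec_ge (fun i j => (le_abs_self _).trans (hC i j)) (x t) i hi).trans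
    (slowMatrix_mulVec_le_velocity hF (h.control_le t ht) (h.w_nonneg t ht) (h.v_le t ht) i)

/-- The running cost over `[0, T]`, corrected by the drift of the linear function `q ⬝ᵥ x`. -/
theorem integral_stageCost (h : S.IsPlay μ x₀ x w v) (q : Fin n → ℝ) {T : ℝ} (hT : 0 ≤ T) :
    ∫ τ in (0 : ℝ)..T, S.stageCost (x τ) (μ (x τ)) (w τ) (v τ) = q ⬝ᵥ x₀ - q ⬝ᵥ x T +
      ∫ τ in (0 : ℝ)..T, (S.stageCost (x τ) (μ (x τ)) (w τ) (v τ) +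
        q ⬝ᵥ S.velocity (x τ) (μ (x τ)) (w τ) (v τ)) := by
  rw [intervalIntegral.integral_add (h.stageCost_integrable hT)
    (h.velocity_integrable.dotProduct q le_rfl hT),
    h.velocity_integrable.integral_dotProduct q le_rfl hT, h.state_eq T hT, dotProduct_add]
  ring

theorem splice (h : S.IsPlay μ x₀ x w v) {T : ℝ} (hT : 0 ≤ T) {x' : ℝ → Fin n → ℝ}
    {w' : ℝ → Fin l → ℝ} {v' : ℝ → Fin c → ℝ} (h' : S.IsPlay μ (x T) x' w' v') :
    S.IsPlay μ x₀ (splice T x x') (splice T w w') (splice T v v') := by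
  have hμ : (fun t => μ (_root_.splice T x x' t)) =
      _root_.splice T (fun t => μ (x t)) fun t => μ (x' t) := by
    ext1 t
    unfold _root_.splice
    split_ifs <;> rfl
  have hvel : (fun t => S.velocity (_root_.splice T x x' t) (μ (_root_.splice T x x' t))
      (_root_.splice T w w' t) (_root_.splice T v v' t)) =
      _root_.splice T (fun t => S.velocity (x t) (μ (x t)) (w t) (v t))
        fun t => S.velocity (x' t) (μ (x' t)) (w' t) (v' t) := by
    ext1 t
    unfold _root_.splice
    split_ifs <;> rfl
  refine ⟨continuousOn_splice h.continuousOn_state h'.continuousOn_state h'.state_zero.symm, ?_,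
    h.w_integrable.splice h'.w_integrable hT, h.v_integrable.splice h'.v_integrable hT,
    fun t ht => ?_, fun t ht => ?_, fun t ht => ?_, fun t ht => ?_⟩
  · rw [hμ]
    exact h.control_integrable.splice h'.control_integrable hT
  · rcases le_or_gt t T with hle | hlt
    · rw [splice_of_le hle]
      exact h.control_le t ht
    · rw [splice_of_lt hlt]
      exact h'.control_le _ (sub_nonneg.2 hlt.le)
  · rcases le_or_gt t T with hle | hlt
    · rw [splice_of_le hle]
      exact h.w_nonneg t ht
    · rw [splice_of_lt hlt]
      exact h'.w_nonneg _ (sub_nonneg.2 hlt.le)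
  · rcases le_or_gt t T with hle | hlt
    · rw [splice_of_le hle, splice_of_le hle]
      exact h.v_le t ht
    · rw [splice_of_lt hlt, splice_of_lt hlt]
      exact h'.v_le _ (sub_nonneg.2 hlt.le)
  · rw [hvel]
    rcases le_or_gt t T with hle | hlt
    · rw [splice_of_le hle, integral_splice_of_le ht hle]
      exact h.state_eq t ht
    · have hs := sub_nonneg.2 hlt.le
      rw [splice_of_lt hlt, integral_splice hT hlt.le (h.velocity_integrable T hT)
        (h'.velocity_integrable _ hs), h'.state_eq _ hs, h.state_eq T hT, add_assoc]

theorem integral_stageCost_splice (h : S.IsPlay μ x₀ x w v) {T : ℝ} (hT : 0 ≤ T)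
    {x' : ℝ → Fin n → ℝ} {w' : ℝ → Fin l → ℝ} {v' : ℝ → Fin c → ℝ}
    (h' : S.IsPlay μ (x T) x' w' v') {t : ℝ} (ht : T ≤ t) :
    ∫ τ in (0 : ℝ)..t, S.stageCost (_root_.splice T x x' τ) (μ (_root_.splice T x x' τ))
      (_root_.splice T w w' τ) (_root_.splice T v v' τ) =
      (∫ τ in (0 : ℝ)..T, S.stageCost (x τ) (μ (x τ)) (w τ) (v τ)) +
        ∫ τ in (0 : ℝ)..(t - T), S.stageCost (x' τ) (μ (x' τ)) (w' τ) (v' τ) := by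
  rw [← integral_splice hT ht (h.stageCost_integrable hT)
    (h'.stageCost_integrable (sub_nonneg.2 ht))]
  congr 1
  ext1 t
  unfold _root_.splice
  split_ifs <;> rfl

end IsPlay

/-- A linear control law that obeys the constraints on the nonnegative orthant is admissible. -/
theorem isAdmissible_linear (hF : ∀ i j, 0 ≤ S.F i j) (hpos : S.PositiveDynamics)
    (hG : ∀ i j, 0 ≤ S.G i j)
    {K : Matrix (Fin m) (Fin n) ℝ} (hK : ∀ x, 0 ≤ x → |K *ᵥ x| ≤ S.E *ᵥ x) :
    S.IsAdmissible (fun x => -(K *ᵥ x)) := by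
  refine ⟨fun x hx => by rw [abs_neg]; exact hK x hx, fun x₀ hx₀ w hw hw0 θ hθ hθ1 => ?_⟩
  let M : (Fin c → ℝ) → Matrix (Fin n) (Fin n) ℝ := fun η =>
    S.A - S.B * K + S.H * (diagonal η * S.G)
  have hMc : Continuous M := continuous_const.add
    (continuous_const.matrix_mul (continuous_id.matrix_diagonal.matrix_mul continuous_const))
  have hMvel : ∀ η x w', S.velocity x (-(K *ᵥ x)) w' (η * (S.G *ᵥ x)) =
      S.F *ᵥ w' + M η *ᵥ x := by
    intro η x w'
    have : η * (S.G *ᵥ x) = (diagonal η * S.G) *ᵥ x := by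
      rw [← mulVec_mulVec]
      ext k
      rw [mulVec_diagonal, Pi.mul_apply]
    rw [this]
    simp only [M, velocity, mulVec_neg, add_mulVec, sub_mulVec, mulVec_mulVec]
    abel
  have hGle : ∀ x, 0 ≤ x → ∀ η : Fin c → ℝ, (∀ k, |η k| ≤ 1) → |η * (S.G *ᵥ x)| ≤ S.G *ᵥ x := by
    intro x hx η hη k
    have h := mulVec_nonneg_of_nonneg hG hx k
    rw [Pi.abs_apply, Pi.mul_apply, abs_mul, abs_of_nonneg h]
    exact mul_le_of_le_one_left h (hη k)
  have hMetz : ∀ η : Fin c → ℝ, (∀ k, |η k| ≤ 1) → IsMetzler (M η) := by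
    intro η hη i j hij
    have he : (0 : Fin n → ℝ) ≤ Pi.single j 1 := Pi.single_nonneg.2 zero_le_one
    have h := hpos (Pi.single j 1) (-(K *ᵥ Pi.single j 1)) 0 (η * (S.G *ᵥ Pi.single j 1)) he
      (by rw [abs_neg]; exact hK _ he) le_rfl (hGle _ he η hη) i (by simp [hij])
    rw [hMvel, mulVec_zero, zero_add, mulVec_single_one] at h
    exact h
  obtain ⟨C, hC⟩ : ∃ C, ∀ η : Fin c → ℝ, (∀ k, |η k| ≤ 1) → ∀ i j, |M η i j| ≤ C := by
    have hf : Continuous fun η => ∑ i, ∑ j, |M η i j| :=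
      continuous_finsetSum _ fun i _ => continuous_finsetSum _ fun j _ =>
        (hMc.matrix_elem i j).abs
    obtain ⟨C, hC⟩ := (isCompact_closedBall (0 : Fin c → ℝ) 1).exists_bound_of_continuousOn
      hf.continuousOn
    refine ⟨C, fun η hη i j => le_trans ?_ ((le_abs_self _).trans (hC η ?_))⟩
    · exact (Finset.single_le_sum (f := fun j => |M η i j|) (fun j _ => abs_nonneg _)
        (Finset.mem_univ j)).trans (Finset.single_le_sum (f := fun i => ∑ j, |M η i j|)
          (fun i _ => Finset.sum_nonneg fun j _ => abs_nonneg _) (Finset.mem_univ i))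
    · rw [mem_closedBall_zero_iff, pi_norm_le_iff_of_nonneg zero_le_one]
      exact hη
  have hMθ : ∀ i j, Measurable fun t => M (θ t) i j := fun i j =>
    (hMc.matrix_elem i j).measurable.comp hθ
  have hMeas : ∀ y : ℝ → Fin n → ℝ, Continuous y → Measurable fun t => M (θ t) *ᵥ y t := by
    intro y hy
    refine measurable_pi_iff.2 fun i => ?_
    simp only [mulVec, dotProduct]
    exact Finset.measurable_fun_sum _ fun j _ =>
      (hMθ i j).mul ((continuous_apply j).comp hy).measurable
  have hC0 : 0 ≤ max C 0 := le_max_right _ _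
  have hnorm : ∀ t, ‖(M (θ t)).mulVecLin.toContinuousLinearMap‖ ≤ n * max C 0 := by
    intro t
    refine ContinuousLinearMap.opNorm_le_bound _ (by positivity) fun x => ?_
    refine (pi_norm_le_iff_of_nonneg (by positivity)).2 fun i => ?_
    calc ‖∑ j, M (θ t) i j * x j‖ ≤ ∑ j, ‖M (θ t) i j * x j‖ := norm_sum_le _ _
      _ ≤ ∑ _j : Fin n, max C 0 * ‖x‖ := by
        refine Finset.sum_le_sum fun j _ => ?_
        rw [norm_mul]
        exact mul_le_mul ((hC _ (hθ1 t) i j).trans (le_max_left _ _)) (norm_le_pi_norm x j)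
          (norm_nonneg _) hC0
      _ = n * max C 0 * ‖x‖ := by simp [mul_assoc]
  have hFw : LocIntegrable fun t => S.F *ᵥ w t := hw.mulVec S.F
  obtain ⟨x, hxc, hx⟩ := exists_solution_linear_volterra
    (fun t => (M (θ t)).mulVecLin.toContinuousLinearMap) hnorm
    (fun y hy => (hMeas y hy).aestronglyMeasurable)
    (fun t => x₀ + ∫ τ in (0 : ℝ)..(max t 0), S.F *ᵥ w τ)
    (continuous_const.add (hFw.continuousOn_primitive.comp_continuous
      (continuous_id.max continuous_const) fun t => Set.mem_Ici.2 (le_max_right _ _)))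
  have hxint : LocIntegrable x := LocIntegrable.of_continuousOn hxc
  have hvint : LocIntegrable fun t => θ t * (S.G *ᵥ x t) :=
    (hxint.mulVec S.G).mul_of_abs_le_one hθ hθ1
  have huint : LocIntegrable fun t => -(K *ᵥ x t) := fun T hT => (hxint.mulVec K T hT).neg
  have hvelint : LocIntegrable fun t => S.velocity (x t) (-(K *ᵥ x t)) (w t)
      (θ t * (S.G *ᵥ x t)) :=
    (((hxint.mulVec S.A).add (huint.mulVec S.B)).add hFw).add (hvint.mulVec S.H)
  have hMxint : LocIntegrable fun t => M (θ t) *ᵥ x t := by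
    intro T hT
    refine ((hvelint T hT).sub (hFw T hT)).congr fun t _ => ?_
    simp [hMvel]
  have hstate : ∀ t, 0 ≤ t → x t = x₀ + ∫ τ in (0 : ℝ)..t,
      S.velocity (x τ) (-(K *ᵥ x τ)) (w τ) (θ τ * (S.G *ᵥ x τ)) := by
    intro t ht
    simp only [hMvel]
    rw [intervalIntegral.integral_add (hFw t ht) (hMxint t ht), hx t ht, max_eq_left ht, add_assoc]
    rfl
  have hnn : ∀ t, 0 ≤ t → 0 ≤ x t := by
    refine fun t ht => nonneg_of_velocity_ge hx₀ hxc hvelint hstate hC0 (fun t ht i hi => ?_) t ht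
    refine ((hMetz _ (hθ1 t)).mulVec_ge (fun i j => ((le_abs_self _).trans
      (hC _ (hθ1 t) i j)).trans (le_max_left _ _)) (x t) i hi).trans ?_
    rw [hMvel, Pi.add_apply]
    exact le_add_of_nonneg_left (mulVec_nonneg_of_nonneg hF (hw0 t ht) i)
  exact ⟨x, hxc, huint, hw, hvint, fun t ht => by rw [abs_neg]; exact hK _ (hnn t ht), hw0,
    fun t ht => hGle _ (hnn t ht) _ (hθ1 t), hstate⟩

theorem abs_mulVec_le_of_mem_gainSet (hE : ∀ i j, 0 ≤ S.E i j) {p : Fin n → ℝ}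
    {K : Matrix (Fin m) (Fin n) ℝ} (hK : K ∈ S.gainSet p) {x : Fin n → ℝ} (hx : 0 ≤ x) :
    |K *ᵥ x| ≤ S.E *ᵥ x := by
  obtain ⟨d, hd, rfl⟩ := hK
  intro k
  have h := mulVec_nonneg_of_nonneg hE hx k
  rw [Pi.abs_apply, ← mulVec_mulVec, mulVec_diagonal, abs_mul, abs_of_nonneg h]
  exact mul_le_of_le_one_left h (abs_le_one_of_mem_signSet (hd k))

theorem gainSet_nonempty (p : Fin n → ℝ) : (S.gainSet p).Nonempty := by
  have h : ∀ i, ∃ d, d ∈ signSet (S.r i + (S.Bᵀ *ᵥ p) i) := by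
    intro i
    unfold signSet
    split_ifs
    exacts [⟨1, rfl⟩, ⟨-1, rfl⟩, ⟨0, by norm_num⟩]
  choose d hd using h
  exact ⟨_, d, hd, rfl⟩

/-- A solution of the Bellman equation bounds the worst-case cost of its control laws. -/
theorem worstCost_le (hF : ∀ i j, 0 ≤ S.F i j) (hM : IsMetzler S.slowMatrix) {p : Fin n → ℝ}
    (hp : p ∈ S.bellmanSet) {K : Matrix (Fin m) (Fin n) ℝ} (hK : K ∈ S.gainSet p)
    {x₀ : Fin n → ℝ} (hx₀ : 0 ≤ x₀) :
    S.worstCost (fun x => -(K *ᵥ x)) x₀ ≤ ((p ⬝ᵥ x₀ : ℝ) : EReal) := by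
  refine iSup_le fun x => iSup_le fun w => iSup_le fun v => iSup_le fun h => ?_
  refine limsup_le_of_le (h := ?_)
  filter_upwards [eventually_ge_atTop 0] with T hT
  rw [EReal.coe_le_coe_iff, h.integral_stageCost p hT]
  have h1 : 0 ≤ p ⬝ᵥ x T := Finset.sum_nonneg fun i _ =>
    mul_nonneg (hp.1 i) (h.state_nonneg hF hM hx₀ hT i)
  have h2 := intervalIntegral.integral_nonneg (μ := volume) hT fun τ hτ =>
    neg_nonneg.2 (stageCost_add_nonpos hp hK (h.w_nonneg τ hτ.1) (h.v_le τ hτ.1))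
  rw [intervalIntegral.integral_neg] at h2
  linarith

theorem value_le (hF : ∀ i j, 0 ≤ S.F i j) (hE : ∀ i j, 0 ≤ S.E i j) (hG : ∀ i j, 0 ≤ S.G i j)
    (hpos : S.PositiveDynamics) {p : Fin n → ℝ} (hp : p ∈ S.bellmanSet) {x₀ : Fin n → ℝ}
    (hx₀ : 0 ≤ x₀) : S.value x₀ ≤ ((p ⬝ᵥ x₀ : ℝ) : EReal) := by
  obtain ⟨K, hK⟩ := S.gainSet_nonempty p
  exact (iInf₂_le _ (isAdmissible_linear hF hpos hG fun x hx =>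
    abs_mulVec_le_of_mem_gainSet hE hK hx)).trans
      (worstCost_le hF (isMetzler_slowMatrix hE hG hpos) hp hK hx₀)

variable (S) in
/-- Against `μ`, the disturbances can secure a cost of at least `a` from `x₀` over all sufficiently
long horizons. -/
def Secures (μ : (Fin n → ℝ) → Fin m → ℝ) (x₀ : Fin n → ℝ) (a : ℝ) : Prop :=
  ∃ x w v, S.IsPlay μ x₀ x w v ∧
    ∀ᶠ T in atTop, a ≤ ∫ τ in (0 : ℝ)..T, S.stageCost (x τ) (μ (x τ)) (w τ) (v τ)

theorem Secures.le_worstCost {μ : (Fin n → ℝ) → Fin m → ℝ} {x₀ : Fin n → ℝ} {a : ℝ}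
    (h : S.Secures μ x₀ a) : (a : EReal) ≤ S.worstCost μ x₀ := by
  obtain ⟨x, w, v, hplay, ha⟩ := h
  refine le_trans ?_ (le_iSup_of_le x <| le_iSup_of_le w <| le_iSup_of_le v <|
    le_iSup_of_le hplay le_rfl)
  exact le_limsup_of_frequently_le (ha.mono fun T hT => EReal.coe_le_coe_iff.2 hT).frequently

theorem le_value {x₀ : Fin n → ℝ} {a : ℝ} (h : ∀ μ, S.IsAdmissible μ → S.Secures μ x₀ a) :
    (a : EReal) ≤ S.value x₀ :=
  le_iInf₂ fun μ hμ => (h μ hμ).le_worstCost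

theorem abs_worstGain_le_one (q : Fin n → ℝ) (k : Fin c) : |S.worstGain q k| ≤ 1 := by
  unfold worstGain
  split_ifs <;> simp

theorem secures_zero (hF : ∀ i j, 0 ≤ S.F i j) (hM : IsMetzler S.slowMatrix)
    (h0 : 0 ≤ S.bellmanResidual 0) {μ : (Fin n → ℝ) → Fin m → ℝ} (hμ : S.IsAdmissible μ)
    {x₀ : Fin n → ℝ} (hx₀ : 0 ≤ x₀) : S.Secures μ x₀ 0 := by
  obtain ⟨x, hx⟩ := hμ.exists_play x₀ hx₀ 0 (fun T _ => intervalIntegrable_const)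
    (fun _ _ => le_rfl)
    (fun _ => S.worstGain 0) measurable_const fun _ k => abs_worstGain_le_one 0 k
  refine ⟨x, _, _, hx, ?_⟩
  filter_upwards [eventually_ge_atTop 0] with T hT
  refine intervalIntegral.integral_nonneg hT fun τ hτ => ?_
  have h := bellmanResidual_le_stageCost_add 0 (hx.control_le τ hτ.1) 0
  rw [zero_dotProduct, add_zero, dotProduct_zero, add_zero] at h
  refine le_trans (Finset.sum_nonneg fun i _ => ?_) h
  exact mul_nonneg (h0 i) (hx.state_nonneg hF hM hx₀ hτ.1 i)

/-- In a positive system whose states decay at most at rate `r`, the time integral of the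
state over `[0, 1]` is at least `(1 + r)⁻¹` times the initial state. -/
theorem IsPlay.le_integral_state (hF : ∀ i j, 0 ≤ S.F i j) (hM : IsMetzler S.slowMatrix) {r : ℝ}
    (hr : 0 ≤ r) (hrM : ∀ i, -r ≤ S.slowMatrix i i) {μ : (Fin n → ℝ) → Fin m → ℝ}
    {x₀ : Fin n → ℝ} (hx₀ : 0 ≤ x₀) {x : ℝ → Fin n → ℝ} {w : ℝ → Fin l → ℝ} {v : ℝ → Fin c → ℝ}
    (h : S.IsPlay μ x₀ x w v) :
    (1 + r)⁻¹ • x₀ ≤ ∫ τ in (0 : ℝ)..1, x τ := by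
  intro i
  rw [h.state_integrable.integral_apply i le_rfl zero_le_one, Pi.smul_apply, smul_eq_mul,
    inv_mul_le_iff₀ (by linarith)]
  have hnn : ∀ t, 0 ≤ t → 0 ≤ x t := fun t ht => h.state_nonneg hF hM hx₀ ht
  have hvel : ∀ t, 0 ≤ t → -r * x t i ≤ S.velocity (x t) (μ (x t)) (w t) (v t) i := by
    intro t ht
    refine le_trans ?_ (slowMatrix_mulVec_le_velocity hF (h.control_le t ht) (h.w_nonneg t ht)
      (h.v_le t ht) i)
    refine (mul_le_mul_of_nonneg_right (hrM i) (hnn t ht i)).trans ?_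
    rw [mulVec, dotProduct, ← Finset.add_sum_erase _ _ (Finset.mem_univ i)]
    exact le_add_of_nonneg_right (Finset.sum_nonneg fun j hj =>
      mul_nonneg (hM i j (Finset.ne_of_mem_erase hj).symm) (hnn t ht j))
  have hint : ∀ a b : ℝ, 0 ≤ a → 0 ≤ b → IntervalIntegrable (fun t => x t i) volume a b :=
    fun a b ha hb => h.state_integrable.apply i ha hb
  have hlow : ∀ t ∈ Set.Icc (0 : ℝ) 1, x₀ i - r * ∫ τ in (0 : ℝ)..1, x τ i ≤ x t i := by
    intro t ht
    have h1 : ∫ τ in (0 : ℝ)..t, -r * x τ i ≤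
        ∫ τ in (0 : ℝ)..t, S.velocity (x τ) (μ (x τ)) (w τ) (v τ) i :=
      intervalIntegral.integral_mono_on ht.1 ((hint 0 t le_rfl ht.1).const_mul _)
        (h.velocity_integrable.apply i le_rfl ht.1) fun τ hτ => hvel τ hτ.1
    rw [intervalIntegral.integral_const_mul] at h1
    have h2 := intervalIntegral.integral_add_adjacent_intervals (hint 0 t le_rfl ht.1)
      (hint t 1 ht.1 zero_le_one)
    have h3 : 0 ≤ ∫ τ in t..1, x τ i := intervalIntegral.integral_nonneg ht.2 fun τ hτ =>
      hnn τ (ht.1.trans hτ.1) i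
    have h4 : x t i = x₀ i + ∫ τ in (0 : ℝ)..t, S.velocity (x τ) (μ (x τ)) (w τ) (v τ) i := by
      rw [h.state_eq t ht.1, Pi.add_apply, h.velocity_integrable.integral_apply i le_rfl ht.1]
    have h5 := mul_nonneg hr h3
    rw [← h2, h4]
    linarith
  have h6 := intervalIntegral.integral_mono_on (μ := volume) zero_le_one intervalIntegrable_const
    (hint 0 1 le_rfl zero_le_one) hlow
  rw [intervalIntegral.integral_const] at h6
  simp only [sub_zero, one_smul] at h6
  linarith

end RegulatorData

namespace RegulatorData

variable {n m l c : ℕ} {S : RegulatorData n m l c}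

/-- If the disturbances can secure `q ⬝ᵥ x₀` from every `x₀ ≥ 0`, then by spending one unit of time
on `worstGain q` and a constant disturbance `ω` first, they can secure more. -/
theorem secures_step (hF : ∀ i j, 0 ≤ S.F i j) (hM : IsMetzler S.slowMatrix) {r : ℝ} (hr : 0 ≤ r)
    (hrM : ∀ i, -r ≤ S.slowMatrix i i) {μ : (Fin n → ℝ) → Fin m → ℝ} (hμ : S.IsAdmissible μ)
    {q : Fin n → ℝ} (hq : 0 ≤ S.bellmanResidual q)
    (hsec : ∀ x₀ : Fin n → ℝ, 0 ≤ x₀ → S.Secures μ x₀ (q ⬝ᵥ x₀)) {ω : Fin l → ℝ} (hω : 0 ≤ ω)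
    {x₀ : Fin n → ℝ} (hx₀ : 0 ≤ x₀) :
    S.Secures μ x₀ ((q + (1 + r)⁻¹ • S.bellmanResidual q) ⬝ᵥ x₀ + (S.Fᵀ *ᵥ q - S.γ) ⬝ᵥ ω) := by
  obtain ⟨x, hx⟩ := hμ.exists_play x₀ hx₀ (fun _ => ω) (fun T _ => intervalIntegrable_const)
    (fun _ _ => hω) (fun _ => S.worstGain q) measurable_const fun _ k => abs_worstGain_le_one q k
  obtain ⟨x', w', v', hx', hcost⟩ := hsec (x 1) (hx.state_nonneg hF hM hx₀ zero_le_one)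
  refine ⟨_, _, _, hx.splice zero_le_one hx', ?_⟩
  have hfirst : (q + (1 + r)⁻¹ • S.bellmanResidual q) ⬝ᵥ x₀ + (S.Fᵀ *ᵥ q - S.γ) ⬝ᵥ ω - q ⬝ᵥ x 1 ≤
      ∫ τ in (0 : ℝ)..1, S.stageCost (x τ) (μ (x τ)) ω (S.worstGain q * (S.G *ᵥ x τ)) := by
    rw [hx.integral_stageCost q zero_le_one]
    have hmono := intervalIntegral.integral_mono_on (μ := volume) zero_le_one
      ((hx.state_integrable.dotProduct (S.bellmanResidual q) le_rfl zero_le_one).add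
        (intervalIntegrable_const (c := (S.Fᵀ *ᵥ q - S.γ) ⬝ᵥ ω)))
      ((hx.stageCost_integrable zero_le_one).add
        (hx.velocity_integrable.dotProduct q le_rfl zero_le_one))
      fun τ hτ => bellmanResidual_le_stageCost_add q (hx.control_le τ hτ.1) ω
    rw [intervalIntegral.integral_add
      (hx.state_integrable.dotProduct (S.bellmanResidual q) le_rfl zero_le_one)
      intervalIntegrable_const, hx.state_integrable.integral_dotProduct _ le_rfl zero_le_one,
      intervalIntegral.integral_const, sub_zero, one_smul] at hmono
    have hstate : S.bellmanResidual q ⬝ᵥ ((1 + r)⁻¹ • x₀) ≤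
        S.bellmanResidual q ⬝ᵥ ∫ τ in (0 : ℝ)..1, x τ :=
      Finset.sum_le_sum fun i _ =>
        mul_le_mul_of_nonneg_left (hx.le_integral_state hF hM hr hrM hx₀ i) (hq i)
    rw [dotProduct_smul] at hstate
    rw [add_dotProduct, smul_dotProduct]
    linarith
  filter_upwards [(tendsto_atTop_add_const_right atTop (-1 : ℝ) tendsto_id).eventually hcost,
    eventually_ge_atTop 1] with T hT hT1
  rw [hx.integral_stageCost_splice zero_le_one hx' hT1]
  have hT' : q ⬝ᵥ x 1 ≤ ∫ τ in (0 : ℝ)..(T - 1), S.stageCost (x' τ) (μ (x' τ)) (w' τ) (v' τ) := hT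
  linarith

/-- One step of relaxed value iteration. -/
noncomputable def valueStep (S : RegulatorData n m l c) (r : ℝ) (q : Fin n → ℝ) : Fin n → ℝ :=
  q + (1 + r)⁻¹ • S.bellmanResidual q

theorem bellmanResidual_valueStep_nonneg (hE : ∀ i j, 0 ≤ S.E i j) (hG : ∀ i j, 0 ≤ S.G i j)
    (hM : IsMetzler S.slowMatrix) {r : ℝ} (hr : 0 ≤ r) (hrM : ∀ i, -r ≤ S.slowMatrix i i)
    {q : Fin n → ℝ} (hq : 0 ≤ S.bellmanResidual q) :
    0 ≤ S.bellmanResidual (S.valueStep r q) := by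
  have hκ : 0 ≤ (1 + r)⁻¹ := by positivity
  have hstep : 0 ≤ S.valueStep r q - q := by
    rw [valueStep, add_sub_cancel_left]
    exact smul_nonneg hκ hq
  intro i
  have h := slowMatrix_mulVec_le_bellmanResidual_sub hE hG (sub_nonneg.1 hstep) i
  have hdiag : -r * (S.valueStep r q - q) i ≤ (S.slowMatrixᵀ *ᵥ (S.valueStep r q - q)) i := by
    rw [mulVec, dotProduct, ← Finset.add_sum_erase _ _ (Finset.mem_univ i)]
    refine le_add_of_le_of_nonneg (mul_le_mul_of_nonneg_right (hrM i) (hstep i))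
      (Finset.sum_nonneg fun j hj => ?_)
    exact mul_nonneg (hM j i (Finset.ne_of_mem_erase hj)) (hstep j)
  have hval : (S.valueStep r q - q) i = (1 + r)⁻¹ * S.bellmanResidual q i := by
    rw [valueStep, add_sub_cancel_left]
    rfl
  have hpos : 0 ≤ (1 + r)⁻¹ * S.bellmanResidual q i := mul_nonneg hκ (hq i)
  have hmul : (1 + r) * ((1 + r)⁻¹ * S.bellmanResidual q i) = S.bellmanResidual q i :=
    mul_inv_cancel_left₀ (by positivity) _
  rw [hval] at hdiag
  rw [Pi.sub_apply] at h
  rw [Pi.zero_apply]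
  linarith

/-- If the value is finite, relaxed value iteration from zero converges to a solution of the
Bellman equation that bounds the value from below. -/
theorem HasFiniteValue.exists_mem_bellmanSet (hF : ∀ i j, 0 ≤ S.F i j) (hE : ∀ i j, 0 ≤ S.E i j)
    (hG : ∀ i j, 0 ≤ S.G i j) (hpos : S.PositiveDynamics)
    (hs : S.Eᵀ *ᵥ |S.r| - S.Gᵀ *ᵥ |S.δ| ≤ S.s) (hfin : S.HasFiniteValue) :
    ∃ p ∈ S.bellmanSet, ∀ x₀ : Fin n → ℝ, 0 ≤ x₀ → ((p ⬝ᵥ x₀ : ℝ) : EReal) ≤ S.value x₀ := by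
  have hM := isMetzler_slowMatrix hE hG hpos
  obtain ⟨r, hr, hrM'⟩ := exists_entry_bound S.slowMatrix
  have hrM : ∀ i, -r ≤ S.slowMatrix i i := fun i => (abs_le.1 (hrM' i i)).1
  have h0 := bellmanResidual_zero_nonneg hs
  let q : ℕ → Fin n → ℝ := fun k => (S.valueStep r)^[k] 0
  have q_succ : ∀ k, q (k + 1) = S.valueStep r (q k) := fun k =>
    Function.iterate_succ_apply' _ _ _
  have hres : ∀ k, 0 ≤ S.bellmanResidual (q k) := by
    intro k
    induction k with
    | zero => exact h0
    | succ k ih =>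
      rw [q_succ]
      exact bellmanResidual_valueStep_nonneg hE hG hM hr hrM ih
  have hsec : ∀ k μ, S.IsAdmissible μ → ∀ x₀ : Fin n → ℝ, 0 ≤ x₀ →
      S.Secures μ x₀ (q k ⬝ᵥ x₀) := by
    intro k
    induction k with
    | zero =>
      intro μ hμ x₀ hx₀
      have h := secures_zero hF hM h0 hμ hx₀
      rwa [← zero_dotProduct x₀] at h
    | succ k ih =>
      intro μ hμ x₀ hx₀
      have h := secures_step hF hM hr hrM hμ (hres k) (ih μ hμ) le_rfl hx₀
      rw [dotProduct_zero, add_zero] at h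
      rwa [q_succ]
  have hle : ∀ k, ∀ x₀ : Fin n → ℝ, 0 ≤ x₀ → ((q k ⬝ᵥ x₀ : ℝ) : EReal) ≤ S.value x₀ :=
    fun k x₀ hx₀ => le_value fun μ hμ => hsec k μ hμ x₀ hx₀
  have hmono : Monotone q := monotone_nat_of_le_succ fun k => by
    rw [q_succ]
    exact le_add_of_nonneg_right (smul_nonneg (by positivity) (hres k))
  have hbdd : BddAbove (Set.range q) := by
    refine ⟨fun i => (S.value (Pi.single i 1)).toReal, ?_⟩
    rintro _ ⟨k, rfl⟩ i
    have he : (0 : Fin n → ℝ) ≤ Pi.single i 1 := Pi.single_nonneg.2 zero_le_one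
    have h := hle k _ he
    rw [dotProduct_single_one, ← EReal.coe_toReal (hfin _ he).1 (hfin _ he).2,
      EReal.coe_le_coe_iff] at h
    exact h
  have hγ : ∀ k, S.Fᵀ *ᵥ q k ≤ S.γ := by
    intro k j
    by_contra hcon
    have hj : 0 < (S.Fᵀ *ᵥ q k - S.γ) j := sub_pos.2 (not_le.1 hcon)
    have hbig : ∀ a : ℝ, 0 ≤ a → (((S.Fᵀ *ᵥ q k - S.γ) j * a : ℝ) : EReal) ≤ S.value 0 := by
      refine fun a ha => le_value fun μ hμ => ?_
      have h := secures_step hF hM hr hrM hμ (hres k) (hsec k μ hμ)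
        (ω := Pi.single j a) (Pi.single_nonneg.2 ha) le_rfl
      rwa [dotProduct_zero, zero_add, dotProduct_single] at h
    obtain ⟨b, hb⟩ : ∃ b : ℝ, (b : EReal) = S.value 0 :=
      ⟨_, EReal.coe_toReal (hfin 0 le_rfl).1 (hfin 0 le_rfl).2⟩
    have h := hbig ((|b| + 1) / (S.Fᵀ *ᵥ q k - S.γ) j) (by positivity)
    rw [mul_div_cancel₀ _ hj.ne', ← hb, EReal.coe_le_coe_iff] at h
    linarith [le_abs_self b]
  have hlim := tendsto_atTop_ciSup hmono hbdd
  set p : Fin n → ℝ := ⨆ k, q k with hp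
  refine ⟨p, mem_bellmanSet_iff.2 ⟨?_, ?_, ?_⟩, fun x₀ hx₀ => ?_⟩
  · exact ge_of_tendsto' hlim fun k => hmono k.zero_le
  · have hcont : Continuous (S.valueStep r) :=
      continuous_id.add
        ((continuous_const_smul ((1 + r)⁻¹)).comp continuous_bellmanResidual)
    have h1 : Tendsto (fun k => q (k + 1)) atTop (nhds (S.valueStep r p)) := by
      simp only [q_succ]
      exact (hcont.tendsto p).comp hlim
    have h2 := tendsto_nhds_unique h1 (hlim.comp (tendsto_add_atTop_nat 1))
    have h3 : (1 + r)⁻¹ • S.bellmanResidual p = 0 := by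
      rwa [valueStep, add_eq_left] at h2
    exact (smul_eq_zero.1 h3).resolve_left (by positivity)
  · have hcont : Continuous fun y => S.Fᵀ *ᵥ y := continuous_const.matrix_mulVec continuous_id
    exact le_of_tendsto' ((hcont.tendsto p).comp hlim) hγ
  · have hcont : Continuous fun y => ((y ⬝ᵥ x₀ : ℝ) : EReal) :=
      continuous_coe_real_ereal.comp (continuous_id.dotProduct continuous_const)
    exact le_of_tendsto' ((hcont.tendsto p).comp hlim) fun k => hle k x₀ hx₀

theorem hasFiniteValue_of_bellmanSet_nonempty (hF : ∀ i j, 0 ≤ S.F i j)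
    (hE : ∀ i j, 0 ≤ S.E i j) (hG : ∀ i j, 0 ≤ S.G i j) (hpos : S.PositiveDynamics)
    (hs : S.Eᵀ *ᵥ |S.r| - S.Gᵀ *ᵥ |S.δ| ≤ S.s) (h : S.bellmanSet.Nonempty) :
    S.HasFiniteValue := by
  obtain ⟨p, hp⟩ := h
  refine fun x₀ hx₀ => ⟨?_, ?_⟩
  · exact ((value_le hF hE hG hpos hp hx₀).trans_lt (EReal.coe_lt_top _)).ne
  · have h := le_value fun μ hμ => secures_zero (S := S) hF (isMetzler_slowMatrix hE hG hpos)
      (bellmanResidual_zero_nonneg hs) hμ hx₀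
    exact ((EReal.bot_lt_coe 0).trans_le h).ne'

end RegulatorData

theorem theorem2 {n m l c : ℕ} (S : RegulatorData n m l c)
    (hF : ∀ i j, 0 ≤ S.F i j) (hE : ∀ i j, 0 ≤ S.E i j) (hErow : ∀ i, S.E i ≠ 0)
    (hG : ∀ i j, 0 ≤ S.G i j) (hγ : 0 ≤ S.γ)
    (hMetzler : IsMetzler (S.A - entryAbs S.B * S.E))
    (hpos : S.PositiveDynamics)
    (hs : S.Eᵀ *ᵥ |S.r| - S.Gᵀ *ᵥ |S.δ| ≤ S.s) :
    (S.HasFiniteValue ↔ S.bellmanSet.Nonempty) ∧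
    (S.HasFiniteValue →
      ∃ p, IsLeast S.bellmanSet p ∧
        (∀ x₀ : Fin n → ℝ, 0 ≤ x₀ → S.value x₀ = ((p ⬝ᵥ x₀ : ℝ) : EReal)) ∧
        ∀ K ∈ S.gainSet p, S.IsOptimal (fun x => -(K *ᵥ x))) := by
  refine ⟨⟨fun h => ?_, S.hasFiniteValue_of_bellmanSet_nonempty hF hE hG hpos hs⟩, fun h => ?_⟩
  · obtain ⟨p, hp, -⟩ := h.exists_mem_bellmanSet hF hE hG hpos hs
    exact ⟨p, hp⟩
  · obtain ⟨p, hp, hlow⟩ := h.exists_mem_bellmanSet hF hE hG hpos hs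
    have hval : ∀ x₀ : Fin n → ℝ, 0 ≤ x₀ → S.value x₀ = ((p ⬝ᵥ x₀ : ℝ) : EReal) :=
      fun x₀ hx₀ => le_antisymm (S.value_le hF hE hG hpos hp hx₀) (hlow x₀ hx₀)
    refine ⟨p, ⟨hp, fun p' hp' i => ?_⟩, hval, fun K hK => ?_⟩
    · have he : (0 : Fin n → ℝ) ≤ Pi.single i 1 := Pi.single_nonneg.2 zero_le_one
      have hle := (hlow _ he).trans (S.value_le hF hE hG hpos hp' he)
      rwa [EReal.coe_le_coe_iff, dotProduct_single_one, dotProduct_single_one] at hle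
    · have hadm := S.isAdmissible_linear hF hpos hG fun x hx =>
        RegulatorData.abs_mulVec_le_of_mem_gainSet hE hK hx
      refine ⟨hadm, fun x₀ hx₀ => le_antisymm ?_ (iInf₂_le _ hadm)⟩
      rw [hval x₀ hx₀]
      exact RegulatorData.worstCost_le hF (RegulatorData.isMetzler_slowMatrix hE hG hpos) hp hK hx₀
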